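/- **Definitions.** Let $X$ be a topological space and $\mathcal O(X)$ its lattice of open sets. A *continuous valuation* on $X$ is a map $\nu:\mathcal O(X)\to[0,\infty]$ with $\nu(\varnothing)=0$, $\nu(U)\le\nu(W)$ for $U\subseteq W$, $\nu(U\cup W)+\nu(U\cap W)=\nu(U)+\nu(W)$, and $\nu(\bigcup_\lambda U_\lambda)=\sup_\lambda\nu(U_\lambda)$ for every directed family of open sets. Let $VX$ be the set of continuous valuations on $X$, with the topology generated by the sets $\{\nu:\nu(U)>r\}$ ($U\subseteq X$ open, $r\in[0,\infty)$). For lower semicontinuous $g:X\to[0,\infty]$ put $$\langle\nu,g\rangle=\int g\,d\nu:=\sup\Big\{\sum_{i=1}^n r_i\,\nu(U_i)\ :\ U_i\subseteq X\text{ open},\ r_i\in[0,\infty],\ \sum_{i=1}^n r_i 1_{U_i}\le g\Big\}.$$ With the action $(f_*\nu)(U)=\nu(f^{-1}(U))$ on continuous maps $f$, the unit $\delta_x(U)=1_U(x)$ and the multiplication $\mathcal E:VVX\to VX$, $(\mathcal E\xi)(U)=\int_{VX}\nu(U)\,d\xi(\nu)$ (equivalently $\langle\mathcal E\xi,g\rangle=\langle\xi,\langle-,g\rangle\rangle$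 for all lower semicontinuous $g$), $(V,\delta,\mathcal E)$ is a monad on the category $\mathbf{Top}$ of topological spaces and continuous maps, the *valuation monad*. A Borel measure $m$ on $X$ is *$\tau$-smooth* if $m(\bigcup_\lambda U_\lambda)=\sup_\lambda m(U_\lambda)$ for every directed family of open sets. Let $PX$ be the set of $\tau$-smooth Borel probability measures on $X$, with the topology induced by the restriction map $\iota_X:PX\to VX$, $\iota_X(p)=p|_{\mathcal O(X)}$; this is the A-topology, generated by the sets $\{p:p(U)>r\}$. With the pushforward $(f_*p)(B)=p(f^{-1}(B))$ of measures, $P$ is a functor $\mathbf{Top}\to\mathbf{Top}$, and $\iota:P\Rightarrow V$ is a natural transformation. **Theorem.** There are natural transformations $\delta:\mathrm{id}\Rightarrow P$ and $E:PP\Rightarrow P$ of endofunctors of $\mathbf{Top}$ such that, for every topological space $X$: 1. $\delta(x)$ is the Dirac measure $A\mapsto 1_A(x)$ for every $x\in X$; 2. for every $\mu\in PPX$ and every Borel set $A\subseteq X$, the function $p\mapsto p(A)$ on $PX$ is Borel measurable and $$(E\mu)(A)=\int_{PX}p(A)\,d\mu(p).$$ Moreover, $(P,\delta,E)$ is a monad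 on $\mathbf{Top}$, and $\iota:(P,\delta,E)\to(V,\delta,\mathcal E)$ is a morphism of monads each of whose components $\iota_X:PX\to VX$ is a subspace embedding. That is, $(P,\delta,E)$ is a submonad of the valuation monad $(V,\delta,\mathcal E)$ on $\mathbf{Top}$. -/

import Mathlib

open TopologicalSpace CategoryTheory
open scoped ENNReal NNReal

universe u

/-- A continuous valuation on `X`: a map from the opens of `X` to `[0, ∞]` that is strict, monotone,
modular and Scott continuous (it preserves suprema of nonempty directed families of opens). -/
@[ext]
structure ContinuousValuation (X : Type u) [TopologicalSpace X] where
  toFun : Opens X → ℝ≥0∞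
  strict : toFun ⊥ = 0
  mono : ∀ U V : Opens X, U ≤ V → toFun U ≤ toFun V
  modular : ∀ U V : Opens X, toFun (U ⊔ V) + toFun (U ⊓ V) = toFun U + toFun V
  scott : ∀ 𝒰 : Set (Opens X), 𝒰.Nonempty → DirectedOn (· ≤ ·) 𝒰 →
    toFun (sSup 𝒰) = ⨆ U ∈ 𝒰, toFun U

namespace ContinuousValuation

section Basic

variable {X : Type u} [TopologicalSpace X]

instance : CoeFun (ContinuousValuation X) (fun _ => Opens X → ℝ≥0∞) := ⟨toFun⟩

/-- The topology on the space `VX` of continuous valuations, with subbasis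
`θ(U, r) = {ν | ν U > r}` for `U` open and `r ∈ [0, ∞)`. -/
instance : TopologicalSpace (ContinuousValuation X) :=
  generateFrom {s | ∃ (U : Opens X) (r : ℝ≥0), s = {ν : ContinuousValuation X | (r : ℝ≥0∞) < ν U}}

/-- The simple function `∑ rᵢ 1_{Uᵢ}` given by a finite list of pairs `(rᵢ, Uᵢ)`. -/
noncomputable def simpleEval (s : List (ℝ≥0∞ × Opens X)) (x : X) : ℝ≥0∞ :=
  (s.map fun p => (p.2 : Set X).indicator (fun _ => p.1) x).sum

/-- The integral `∑ rᵢ ν(Uᵢ)` of the simple function `∑ rᵢ 1_{Uᵢ}`. -/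
noncomputable def simpleInt (ν : ContinuousValuation X) (s : List (ℝ≥0∞ × Opens X)) : ℝ≥0∞ :=
  (s.map fun p => p.1 * ν p.2).sum

/-- The lower integral `⟨ν, g⟩ = ∫ g dν` of a (lower semicontinuous) function `g : X → [0, ∞]`:
the supremum of the integrals of the simple functions below `g`. -/
noncomputable def pairing (ν : ContinuousValuation X) (g : X → ℝ≥0∞) : ℝ≥0∞ :=
  ⨆ (s : List (ℝ≥0∞ × Opens X)) (_ : ∀ x, simpleEval s x ≤ g x), simpleInt ν s

end Basic

/-! ### The lower integral is well defined, additive and Scott continuous -/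

theorem exists_weights {T : Type*} [PartialOrder T] [Fintype T] (N : Set T → ℝ≥0∞)
    (h0 : N ∅ = 0) (hm : ∀ A B, IsUpperSet A → IsUpperSet B → A ⊆ B → N A ≤ N B)
    (hmod : ∀ A B, IsUpperSet A → IsUpperSet B → N (A ∪ B) + N (A ∩ B) = N A + N B)
    (A : Set T) (hA : IsUpperSet A) :
    N A = ∑ t, A.indicator (fun t => N (Set.Ici t) - N (Set.Ioi t)) t := by
  classical
  induction hn : A.ncard using Nat.strong_induction_on generalizing A with
  | _ n ih =>
    rcases A.eq_empty_or_nonempty with rfl | hne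
    · simp [h0]
    obtain ⟨t, ht⟩ := A.toFinite.exists_minimal hne
    have htA : t ∈ A := ht.prop
    have hA' : IsUpperSet (A \ {t}) := by
      rintro a b hab ⟨ha, hat⟩
      refine ⟨hA hab ha, ?_⟩
      rintro rfl
      exact hat (le_antisymm hab (ht.le_of_le ha hab))
    have hI : IsUpperSet (Set.Ici t) := isUpperSet_Ici t
    have hO : IsUpperSet (Set.Ioi t) := isUpperSet_Ioi t
    have hle : N (Set.Ioi t) ≤ N (Set.Ici t) := hm _ _ hO hI Set.Ioi_subset_Ici_self
    have hsub : Set.Ioi t ⊆ A \ {t} := fun s hs => ⟨hA (le_of_lt hs) htA, ne_of_gt hs⟩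
    have e1 : A \ {t} ∪ Set.Ici t = A := by
      ext s
      constructor
      · rintro (h | h)
        · exact h.1
        · exact hA h htA
      · intro h
        by_cases hs : s = t
        · exact Or.inr (by simp [hs])
        · exact Or.inl ⟨h, hs⟩
    have e2 : A \ {t} ∩ Set.Ici t = Set.Ioi t := by
      ext s
      constructor
      · rintro ⟨h, h'⟩
        exact lt_of_le_of_ne h' (fun e => h.2 e.symm)
      · intro h
        exact ⟨hsub h, le_of_lt h⟩
    have key := hmod _ _ hA' hI
    rw [e1, e2] at key
    have hstep : N A = N (A \ {t}) + (N (Set.Ici t) - N (Set.Ioi t)) := by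
      by_cases hfin : N (Set.Ioi t) = ∞
      · have h1 : N (A \ {t}) = ∞ := top_le_iff.1 (hfin ▸ hm _ _ hO hA' hsub)
        have h2 : N A = ∞ := top_le_iff.1 (h1 ▸ hm _ _ hA' hA Set.sdiff_subset)
        simp [h1, h2]
      · have : N (Set.Ici t) = N (Set.Ioi t) + (N (Set.Ici t) - N (Set.Ioi t)) :=
          (add_tsub_cancel_of_le hle).symm
        refine (ENNReal.add_right_inj hfin).1 ?_
        rw [add_comm, key]
        conv_lhs => rw [this]
        ring
    have hcard : (A \ {t}).ncard < n := by
      rw [← hn]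
      exact Set.ncard_sdiff_singleton_lt_of_mem htA A.toFinite
    rw [hstep, ih _ hcard _ hA' rfl]
    rw [← Finset.add_sum_erase _ _ (Finset.mem_univ t),
      ← Finset.add_sum_erase (Finset.univ) (A.indicator _) (Finset.mem_univ t)]
    rw [Set.indicator_of_notMem (by simp), zero_add, Set.indicator_of_mem htA, add_comm]
    congr 1
    refine Finset.sum_congr rfl fun s hs => ?_
    have : s ≠ t := Finset.ne_of_mem_erase hs
    by_cases h : s ∈ A <;> simp [Set.indicator, h, this]

section Basic

variable {X : Type u} [TopologicalSpace X]

/-- On finitely many opens, a continuous valuation agrees with a finite discrete measure. -/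
theorem exists_discrete (ν : ContinuousValuation X) (F : Set (Opens X)) (hF : F.Finite) :
    ∃ (S : Finset X) (w : X → ℝ≥0∞), ∀ U ∈ F, ν U = ∑ x ∈ S, (U : Set X).indicator w x := by
  classical
  have := hF.fintype
  let σ : X → Finset F := fun x => Finset.univ.filter fun U => x ∈ (U : Opens X)
  have hσ : ∀ x (U : F), U ∈ σ x ↔ x ∈ (U : Opens X) := by simp [σ]
  have hopen : ∀ A : Set (Finset F), IsUpperSet A → IsOpen (σ ⁻¹' A) := by
    intro A hA
    rw [isOpen_iff_forall_mem_open]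
    intro x hx
    refine ⟨⋂ U ∈ σ x, ((U : Opens X) : Set X), ?_, ?_, ?_⟩
    · intro y hy
      refine hA (a := σ x) (b := σ y) ?_ hx
      intro U hU
      rw [hσ]
      exact Set.mem_iInter₂.1 hy U hU
    · exact isOpen_biInter_finset fun U _ => U.1.isOpen
    · exact Set.mem_iInter₂.2 fun U hU => (hσ x U).1 hU
  let N : Set (Finset F) → ℝ≥0∞ := fun A => ν (Opens.interior (σ ⁻¹' A))
  have hN : ∀ A (hA : IsUpperSet A), N A = ν ⟨σ ⁻¹' A, hopen A hA⟩ := by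
    intro A hA
    change ν _ = ν _
    congr 1
    ext1
    exact (hopen A hA).interior_eq
  have hw := exists_weights N
    (by
      rw [hN _ isUpperSet_empty, ← ν.strict]
      congr 1)
    (by
      intro A B hA hB hAB
      rw [hN A hA, hN B hB]
      exact ν.mono _ _ (fun x hx => hAB hx))
    (by
      intro A B hA hB
      rw [hN _ (hA.union hB), hN _ (hA.inter hB), hN A hA, hN B hB]
      exact ν.modular ⟨σ ⁻¹' A, hopen A hA⟩ ⟨σ ⁻¹' B, hopen B hB⟩)
  have hzero : ∀ t : Finset F, t ∉ Set.range σ → N (Set.Ici t) - N (Set.Ioi t) = 0 := by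
    intro t ht
    have : N (Set.Ici t) = N (Set.Ioi t) := by
      change ν (Opens.interior (σ ⁻¹' _)) = ν (Opens.interior (σ ⁻¹' _))
      congr 2
      ext x
      constructor
      · intro h
        exact lt_of_le_of_ne h (fun e => ht ⟨x, e.symm⟩)
      · intro h
        exact le_of_lt (show t < σ x from h)
    simp [this]
  let R : Finset (Finset F) := Finset.univ.filter fun t => t ∈ Set.range σ
  have hR : ∀ t : R, ∃ x, σ x = t := fun t => by
    have := t.2
    simpa [R] using this
  choose q hq using hR
  refine ⟨R.attach.image q, fun x => N (Set.Ici (σ x)) - N (Set.Ioi (σ x)), ?_⟩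
  intro U hU
  have hup : IsUpperSet {t : Finset F | (⟨U, hU⟩ : F) ∈ t} := fun a b hab h => hab h
  have h1 : ν U = N {t : Finset F | (⟨U, hU⟩ : F) ∈ t} := by
    rw [hN _ hup]
    congr 1
    ext x
    exact (hσ x ⟨U, hU⟩).symm
  rw [h1, hw _ hup, Finset.sum_image]
  · rw [← Finset.sum_subset (Finset.subset_univ R), ← Finset.sum_attach]
    · refine Finset.sum_congr rfl fun t _ => ?_
      have h2 : (q t ∈ U) ↔ (⟨U, hU⟩ : F) ∈ (t : Finset F) := by
        rw [← hq t, hσ]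
      by_cases h : q t ∈ U
      · have h3 := h2.1 h
        simp only [Set.indicator, Set.mem_ofPred_eq, h3, if_true, SetLike.mem_coe, h, hq]
      · have h3 : ¬ (⟨U, hU⟩ : F) ∈ (t : Finset F) := fun h' => h (h2.2 h')
        simp only [Set.indicator, Set.mem_ofPred_eq, h3, if_false, SetLike.mem_coe, h]
    · intro t _ ht
      have : t ∉ Set.range σ := by simpa [R] using ht
      simp [Set.indicator, hzero t this]
  · intro a _ b _ hab
    exact Subtype.ext (by rw [← hq a, ← hq b, hab])

theorem simpleInt_eq_of_discrete (ν : ContinuousValuation X) (S : Finset X) (w : X → ℝ≥0∞)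
    (s : List (ℝ≥0∞ × Opens X))
    (h : ∀ p ∈ s, ν p.2 = ∑ x ∈ S, (p.2 : Set X).indicator w x) :
    simpleInt ν s = ∑ x ∈ S, w x * simpleEval s x := by
  induction s with
  | nil => simp [simpleInt, simpleEval]
  | cons p s ih =>
    have h1 := ih fun q hq => h q (List.mem_cons_of_mem _ hq)
    have h2 := h p List.mem_cons_self
    simp only [simpleInt, simpleEval, List.map_cons, List.sum_cons] at h1 ⊢
    rw [h1, h2, Finset.mul_sum, ← Finset.sum_add_distrib]
    refine Finset.sum_congr rfl fun x _ => ?_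
    rw [mul_add]
    congr 1
    by_cases hx : x ∈ (p.2 : Set X) <;> simp [Set.indicator, hx, mul_comm]

/-- The integral of a simple function depends, monotonically, only on the function. -/
theorem simpleInt_mono (ν : ContinuousValuation X) {s t : List (ℝ≥0∞ × Opens X)}
    (h : ∀ x, simpleEval s x ≤ simpleEval t x) : simpleInt ν s ≤ simpleInt ν t := by
  obtain ⟨S, w, hw⟩ := exists_discrete ν {U | ∃ p ∈ s ++ t, p.2 = U}
    (((s ++ t).finite_toSet.image Prod.snd).subset (by rintro U ⟨p, hp, rfl⟩; exact ⟨p, hp, rfl⟩))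
  rw [simpleInt_eq_of_discrete ν S w s fun p hp => hw _ ⟨p, by simp [hp], rfl⟩,
    simpleInt_eq_of_discrete ν S w t fun p hp => hw _ ⟨p, by simp [hp], rfl⟩]
  exact Finset.sum_le_sum fun x _ => mul_le_mul_right (h x) _

theorem pairing_simpleEval (ν : ContinuousValuation X) (s : List (ℝ≥0∞ × Opens X)) :
    pairing ν (simpleEval s) = simpleInt ν s :=
  le_antisymm (iSup₂_le fun _ ht => simpleInt_mono ν ht) (le_iSup₂_of_le s (fun _ => le_rfl) le_rfl)

theorem pairing_mono (ν : ContinuousValuation X) {f g : X → ℝ≥0∞} (h : ∀ x, f x ≤ g x) :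
    pairing ν f ≤ pairing ν g :=
  iSup₂_le fun s hs => le_iSup₂_of_le s (fun x => (hs x).trans (h x)) le_rfl

end Basic

/-- The `n`-th dyadic lower approximation of `v`. -/
noncomputable def dyad (n : ℕ) (v : ℝ≥0∞) : ℝ≥0∞ :=
  ∑ k ∈ Finset.range (4 ^ n), if ((k + 1 : ℕ) : ℝ≥0∞) / 2 ^ n < v then (1 : ℝ≥0∞) / 2 ^ n else 0

theorem dyad_mono {v v' : ℝ≥0∞} (n : ℕ) (h : v ≤ v') : dyad n v ≤ dyad n v' := by
  refine Finset.sum_le_sum fun k _ => ?_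
  split_ifs with h1 h2
  · exact le_rfl
  · exact absurd (h1.trans_le h) h2
  · exact zero_le
  · exact le_rfl

theorem dyad_le (n : ℕ) (v : ℝ≥0∞) : dyad n v ≤ v := by
  have key : ∀ m : ℕ, (∑ k ∈ Finset.range m,
      if ((k + 1 : ℕ) : ℝ≥0∞) / 2 ^ n < v then (1 : ℝ≥0∞) / 2 ^ n else 0) ≤ v := by
    intro m
    induction m with
    | zero => simp
    | succ m ih =>
      rw [Finset.sum_range_succ]
      split_ifs with h
      · refine le_trans ?_ h.le
        calc _ ≤ (∑ k ∈ Finset.range m, (1 : ℝ≥0∞) / 2 ^ n) + 1 / 2 ^ n := by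
              gcongr
              split_ifs <;> simp
          _ = ((m + 1 : ℕ) : ℝ≥0∞) / 2 ^ n := by
              simp [div_eq_mul_inv]
              ring
      · simpa using ih
  exact key _

theorem dyad_monotone (v : ℝ≥0∞) : Monotone fun n => dyad n v := by
  refine monotone_nat_of_le_succ fun n => ?_
  have h2 : ∀ (m : ℕ) (f : ℕ → ℝ≥0∞),
      ∑ k ∈ Finset.range (2 * m), f k = ∑ k ∈ Finset.range m, (f (2 * k) + f (2 * k + 1)) := by
    intro m f
    induction m with
    | zero => simp
    | succ m ih =>
      rw [show 2 * (m + 1) = 2 * m + 1 + 1 by ring, Finset.sum_range_succ, Finset.sum_range_succ,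
        Finset.sum_range_succ, ih, add_assoc]
  have h20 : (2 : ℝ≥0∞) ≠ 0 := by norm_num
  have h2t : (2 : ℝ≥0∞) ≠ ∞ := by norm_num
  have hdiv : ∀ a : ℝ≥0∞, 2 * a / 2 ^ (n + 1) = a / 2 ^ n := by
    intro a
    rw [pow_succ', ENNReal.mul_div_mul_left _ _ h20 h2t]
  calc dyad n v
      ≤ ∑ k ∈ Finset.range (2 * 4 ^ n),
          if ((k + 1 : ℕ) : ℝ≥0∞) / 2 ^ (n + 1) < v then (1 : ℝ≥0∞) / 2 ^ (n + 1) else 0 := by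
        rw [h2]
        refine Finset.sum_le_sum fun k _ => ?_
        split_ifs with h h3 h4 h4
        · rw [← hdiv 1, ← ENNReal.add_div]
          norm_num
        · exact absurd (by
            rw [show 2 * k + 1 + 1 = 2 * (k + 1) by ring, Nat.cast_mul, Nat.cast_ofNat, hdiv]
            exact h) h4
        · refine absurd (lt_of_le_of_lt ?_ h) h3
          rw [← hdiv]
          gcongr
          exact_mod_cast (by omega : 2 * k + 1 ≤ 2 * (k + 1))
        · exact absurd (by
            rw [show 2 * k + 1 + 1 = 2 * (k + 1) by ring, Nat.cast_mul, Nat.cast_ofNat, hdiv]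
            exact h) h4
        all_goals exact zero_le
    _ ≤ dyad (n + 1) v := by
        refine Finset.sum_le_sum_of_subset (Finset.range_mono ?_)
        rw [pow_succ', show 4 * 4 ^ n = 2 * 4 ^ n + 2 * 4 ^ n by ring]
        omega

theorem iSup_dyad (v : ℝ≥0∞) : ⨆ n, dyad n v = v := by
  refine le_antisymm (iSup_le fun n => dyad_le n v) (le_of_forall_lt fun c hc => ?_)
  obtain ⟨a, hca, hav⟩ := ENNReal.lt_iff_exists_nnreal_btwn.1 hc
  obtain ⟨b, hab, hbv⟩ := ENNReal.lt_iff_exists_nnreal_btwn.1 hav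
  have hab' : (a : ℝ) < b := by exact_mod_cast hab
  obtain ⟨n₁, hn₁⟩ := pow_unbounded_of_one_lt (1 / ((b : ℝ) - a)) (one_lt_two)
  obtain ⟨n₂, hn₂⟩ := pow_unbounded_of_one_lt ((b : ℝ)) (one_lt_two)
  set n := max n₁ n₂
  have hp : (0 : ℝ) < 2 ^ n := by positivity
  have h1 : 1 / ((b : ℝ) - a) < 2 ^ n :=
    hn₁.trans_le (pow_le_pow_right₀ one_le_two (le_max_left _ _))
  have h2 : (b : ℝ) < 2 ^ n := hn₂.trans_le (pow_le_pow_right₀ one_le_two (le_max_right _ _))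
  have h3 : 1 < ((b : ℝ) - a) * 2 ^ n := by
    rwa [div_lt_iff₀ (sub_pos.2 hab'), mul_comm] at h1
  set m := ⌊(a : ℝ) * 2 ^ n⌋₊ + 1
  have hm1 : (a : ℝ) * 2 ^ n ≤ m := by
    have := Nat.lt_floor_add_one ((a : ℝ) * 2 ^ n)
    simp only [m]
    push_cast
    exact this.le
  have hm2 : (m : ℝ) < b * 2 ^ n := by
    have := Nat.floor_le (show 0 ≤ (a : ℝ) * 2 ^ n by positivity)
    simp only [m]
    push_cast
    nlinarith
  have hm3 : m ≤ 4 ^ n := by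
    have : (m : ℝ) ≤ (4 : ℝ) ^ n := by
      rw [show (4 : ℝ) = 2 * 2 by norm_num, mul_pow]
      nlinarith
    exact_mod_cast this
  have hmb : ∀ k < m, ((k + 1 : ℕ) : ℝ≥0∞) / 2 ^ n < v := by
    intro k hk
    refine lt_of_le_of_lt ?_ hbv
    refine ENNReal.div_le_of_le_mul ?_
    have : ((k + 1 : ℕ) : ℝ≥0) ≤ b * 2 ^ n := by
      have : ((k + 1 : ℕ) : ℝ) ≤ b * 2 ^ n :=
        (show ((k + 1 : ℕ) : ℝ) ≤ m by exact_mod_cast hk).trans hm2.le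
      exact_mod_cast this
    exact_mod_cast this
  refine hca.trans_le (le_iSup_of_le n ?_)
  calc (a : ℝ≥0∞) ≤ (m : ℝ≥0∞) / 2 ^ n := by
        rw [ENNReal.le_div_iff_mul_le (by simp) (by simp)]
        exact_mod_cast hm1
    _ = ∑ k ∈ Finset.range m, (1 : ℝ≥0∞) / 2 ^ n := by simp [div_eq_mul_inv]
    _ = ∑ k ∈ Finset.range m,
          if ((k + 1 : ℕ) : ℝ≥0∞) / 2 ^ n < v then (1 : ℝ≥0∞) / 2 ^ n else 0 :=
        Finset.sum_congr rfl fun k hk => by rw [if_pos (hmb k (Finset.mem_range.1 hk))]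
    _ ≤ dyad n v := Finset.sum_le_sum_of_subset (Finset.range_mono hm3)

section Basic

variable {X : Type u} [TopologicalSpace X]

/-- The (open, for lower semicontinuous `g`) superlevel set `{g > c}`. -/
def level (g : X → ℝ≥0∞) (c : ℝ≥0∞) : Opens X := Opens.interior (g ⁻¹' Set.Ioi c)

theorem mem_level {g : X → ℝ≥0∞} (hg : LowerSemicontinuous g) {c : ℝ≥0∞} {x : X} :
    x ∈ level g c ↔ c < g x := by
  change x ∈ interior _ ↔ _
  rw [(hg.isOpen_preimage c).interior_eq]
  rfl

theorem coe_level {g : X → ℝ≥0∞} (hg : LowerSemicontinuous g) (c : ℝ≥0∞) :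
    (level g c : Set X) = g ⁻¹' Set.Ioi c :=
  (hg.isOpen_preimage c).interior_eq

/-- The `n`-th dyadic simple function below `g`. -/
noncomputable def dyadSimple (n : ℕ) (g : X → ℝ≥0∞) : List (ℝ≥0∞ × Opens X) :=
  (List.range (4 ^ n)).map fun k => (1 / 2 ^ n, level g (((k + 1 : ℕ) : ℝ≥0∞) / 2 ^ n))

theorem list_range_sum (f : ℕ → ℝ≥0∞) (m : ℕ) :
    ((List.range m).map f).sum = ∑ k ∈ Finset.range m, f k := by
  induction m with
  | zero => simp
  | succ m ih => simp [List.range_succ, Finset.sum_range_succ, ih]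

theorem simpleEval_dyadSimple (n : ℕ) {g : X → ℝ≥0∞} (hg : LowerSemicontinuous g) (x : X) :
    simpleEval (dyadSimple n g) x = dyad n (g x) := by
  classical
  simp only [simpleEval, dyadSimple, List.map_map, list_range_sum, dyad, Function.comp_def]
  refine Finset.sum_congr rfl fun k _ => ?_
  rw [coe_level hg]
  simp [Set.indicator]

theorem simpleInt_dyadSimple (ν : ContinuousValuation X) (n : ℕ) (g : X → ℝ≥0∞) :
    simpleInt ν (dyadSimple n g) =
      ∑ k ∈ Finset.range (4 ^ n), 1 / 2 ^ n * ν (level g (((k + 1 : ℕ) : ℝ≥0∞) / 2 ^ n)) := by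
  simp only [simpleInt, dyadSimple, List.map_map, list_range_sum, Function.comp_def]

theorem simpleInt_dyadSimple_monotone (ν : ContinuousValuation X) {g : X → ℝ≥0∞}
    (hg : LowerSemicontinuous g) : Monotone fun n => simpleInt ν (dyadSimple n g) := by
  intro m n hmn
  refine simpleInt_mono ν fun x => ?_
  rw [simpleEval_dyadSimple _ hg, simpleEval_dyadSimple _ hg]
  exact dyad_monotone _ hmn

theorem lowerSemicontinuous_simpleEval (s : List (ℝ≥0∞ × Opens X)) :
    LowerSemicontinuous (simpleEval s) := by
  induction s with
  | nil => exact lowerSemicontinuous_const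
  | cons p s ih =>
    exact (p.2.isOpen.lowerSemicontinuous_indicator zero_le).add ih

theorem finite_range_simpleEval (s : List (ℝ≥0∞ × Opens X)) : (Set.range (simpleEval s)).Finite := by
  induction s with
  | nil => exact (Set.finite_singleton 0).subset (by rintro _ ⟨x, rfl⟩; simp [simpleEval])
  | cons p s ih =>
    refine (((Set.finite_singleton p.1).insert 0).image2 (· + ·) ih).subset ?_
    rintro _ ⟨x, rfl⟩
    refine ⟨(p.2 : Set X).indicator (fun _ => p.1) x, ?_, simpleEval s x, ⟨x, rfl⟩, rfl⟩
    by_cases hx : x ∈ (p.2 : Set X) <;> simp [Set.indicator, hx]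

theorem simpleInt_eq_iSup (ν : ContinuousValuation X) (s : List (ℝ≥0∞ × Opens X)) :
    simpleInt ν s = ⨆ n, simpleInt ν (dyadSimple n (simpleEval s)) := by
  have hs := lowerSemicontinuous_simpleEval s
  have hfin : ({U | ∃ p ∈ s, p.2 = U} ∪ Set.range (level (simpleEval s))).Finite := by
    refine Set.Finite.union (s.finite_toSet.image Prod.snd) ?_
    refine (((finite_range_simpleEval s).finite_subsets).image
      fun B => Opens.interior (simpleEval s ⁻¹' B)).subset ?_
    rintro _ ⟨c, rfl⟩
    refine ⟨Set.range (simpleEval s) ∩ Set.Ioi c, Set.inter_subset_left, ?_⟩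
    change Opens.interior _ = Opens.interior _
    congr 1
    ext x
    simp
  obtain ⟨S, w, hw⟩ := exists_discrete ν _ hfin
  have h1 := simpleInt_eq_of_discrete ν S w s fun p hp => hw _ (Or.inl ⟨p, hp, rfl⟩)
  have h2 : ∀ n, simpleInt ν (dyadSimple n (simpleEval s)) =
      ∑ x ∈ S, w x * dyad n (simpleEval s x) := by
    intro n
    rw [simpleInt_eq_of_discrete ν S w]
    · exact Finset.sum_congr rfl fun x _ => by rw [simpleEval_dyadSimple n hs]
    · intro p hp
      obtain ⟨k, _, rfl⟩ := List.mem_map.1 hp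
      exact hw _ (Or.inr ⟨_, rfl⟩)
  rw [h1, iSup_congr h2, ← ENNReal.finsetSum_iSup_of_monotone]
  · exact Finset.sum_congr rfl fun x _ => by rw [← ENNReal.mul_iSup, iSup_dyad]
  · intro x m n hmn
    exact mul_le_mul_right (dyad_monotone _ hmn) _

theorem pairing_eq_iSup (ν : ContinuousValuation X) {g : X → ℝ≥0∞} (hg : LowerSemicontinuous g) :
    pairing ν g = ⨆ n, simpleInt ν (dyadSimple n g) := by
  refine le_antisymm (iSup₂_le fun s hs => ?_) (iSup_le fun n => ?_)
  · rw [simpleInt_eq_iSup]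
    refine iSup_mono fun n => simpleInt_mono ν fun x => ?_
    rw [simpleEval_dyadSimple _ hg, simpleEval_dyadSimple _ (lowerSemicontinuous_simpleEval s)]
    exact dyad_mono n (hs x)
  · refine le_iSup₂_of_le (dyadSimple n g) (fun x => ?_) le_rfl
    rw [simpleEval_dyadSimple _ hg]
    exact dyad_le _ _

theorem pairing_iSup (ν : ContinuousValuation X) {ι : Type*} [Nonempty ι] (g : ι → X → ℝ≥0∞)
    (hg : ∀ i, LowerSemicontinuous (g i)) (hd : Directed (· ≤ ·) g) :
    pairing ν (fun x => ⨆ i, g i x) = ⨆ i, pairing ν (g i) := by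
  have hlev : ∀ c, ν (level (fun x => ⨆ i, g i x) c) = ⨆ i, ν (level (g i) c) := by
    intro c
    have h1 : level (fun x => ⨆ i, g i x) c = sSup (Set.range fun i => level (g i) c) := by
      ext x
      rw [SetLike.mem_coe, mem_level (lowerSemicontinuous_iSup hg), lt_iSup_iff, SetLike.mem_coe,
        Opens.mem_sSup]
      simp [mem_level (hg _)]
    rw [h1, ν.scott _ (Set.range_nonempty _), iSup_range]
    rintro _ ⟨i, rfl⟩ _ ⟨j, rfl⟩
    obtain ⟨k, hik, hjk⟩ := hd i j
    refine ⟨_, ⟨k, rfl⟩, ?_, ?_⟩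
    · intro x hx
      exact (mem_level (hg k)).2 (((mem_level (hg i)).1 hx).trans_le (hik x))
    · intro x hx
      exact (mem_level (hg k)).2 (((mem_level (hg j)).1 hx).trans_le (hjk x))
  have hmono : ∀ i k, g i ≤ g k → ∀ c, ν (level (g i) c) ≤ ν (level (g k) c) := by
    intro i k hik c
    exact ν.mono _ _ fun x hx =>
      (mem_level (hg k)).2 (((mem_level (hg i)).1 hx).trans_le (hik x))
  rw [pairing_eq_iSup ν (lowerSemicontinuous_iSup hg)]
  simp_rw [pairing_eq_iSup ν (hg _), simpleInt_dyadSimple, hlev, ENNReal.mul_iSup]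
  rw [iSup_comm]
  refine iSup_congr fun n => ?_
  rw [ENNReal.finsetSum_iSup]
  intro i j
  obtain ⟨k, hik, hjk⟩ := hd i j
  exact ⟨k, fun a => ⟨mul_le_mul_right (hmono i k hik _) _, mul_le_mul_right (hmono j k hjk _) _⟩⟩

theorem pairing_add (ν : ContinuousValuation X) {f g : X → ℝ≥0∞} (hf : LowerSemicontinuous f)
    (hg : LowerSemicontinuous g) :
    pairing ν (fun x => f x + g x) = pairing ν f + pairing ν g := by
  have he : ∀ n x, simpleEval (dyadSimple n f ++ dyadSimple n g) x =
      dyad n (f x) + dyad n (g x) := by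
    intro n x
    rw [← simpleEval_dyadSimple n hf, ← simpleEval_dyadSimple n hg]
    simp [simpleEval]
  have h1 : (fun x => f x + g x) =
      fun x => ⨆ n, simpleEval (dyadSimple n f ++ dyadSimple n g) x := by
    funext x
    simp_rw [he]
    rw [← ENNReal.iSup_add_iSup_of_monotone (dyad_monotone _) (dyad_monotone _), iSup_dyad,
      iSup_dyad]
  rw [h1, pairing_iSup ν _ (fun n => lowerSemicontinuous_simpleEval _), pairing_eq_iSup ν hf,
    pairing_eq_iSup ν hg, ENNReal.iSup_add_iSup_of_monotone (simpleInt_dyadSimple_monotone ν hf)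
      (simpleInt_dyadSimple_monotone ν hg)]
  · refine iSup_congr fun n => ?_
    rw [pairing_simpleEval]
    simp [simpleInt]
  · refine Monotone.directed_le fun m n hmn x => ?_
    rw [he, he]
    exact add_le_add (dyad_monotone _ hmn) (dyad_monotone _ hmn)

theorem pairing_const_mul (ν : ContinuousValuation X) (c : ℝ≥0∞) {f : X → ℝ≥0∞}
    (hf : LowerSemicontinuous f) :
    pairing ν (fun x => c * f x) = c * pairing ν f := by
  have hs : ∀ (s : List (ℝ≥0∞ × Opens X)) x,
      simpleEval (s.map fun p => (c * p.1, p.2)) x = c * simpleEval s x := by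
    intro s x
    simp only [simpleEval, List.map_map, ← List.sum_map_mul_left, Function.comp_def]
    congr 2
    funext p
    by_cases hx : x ∈ (p.2 : Set X) <;> simp [Set.indicator, hx]
  have he : ∀ n x, simpleEval ((dyadSimple n f).map fun p => (c * p.1, p.2)) x =
      c * dyad n (f x) := by
    intro n x
    rw [hs, simpleEval_dyadSimple n hf]
  have h1 : (fun x => c * f x) =
      fun x => ⨆ n, simpleEval ((dyadSimple n f).map fun p => (c * p.1, p.2)) x := by
    funext x
    simp_rw [he]
    rw [← ENNReal.mul_iSup, iSup_dyad]
  rw [h1, pairing_iSup ν _ (fun n => lowerSemicontinuous_simpleEval _), pairing_eq_iSup ν hf,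
    ENNReal.mul_iSup]
  · refine iSup_congr fun n => ?_
    rw [pairing_simpleEval]
    simp only [simpleInt, List.map_map, ← List.sum_map_mul_left, Function.comp_def, mul_assoc]
  · refine Monotone.directed_le fun m n hmn x => ?_
    rw [he, he]
    exact mul_le_mul_right (dyad_monotone _ hmn) _

theorem pairing_zero (ν : ContinuousValuation X) : pairing ν (fun _ => 0) = 0 := by
  have h : simpleEval ([] : List (ℝ≥0∞ × Opens X)) = fun _ => 0 := by
    funext x
    simp [simpleEval]
  rw [← h, pairing_simpleEval]
  simp [simpleInt]

theorem pairing_sum (ν : ContinuousValuation X) {ι : Type*} (t : Finset ι) (f : ι → X → ℝ≥0∞)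
    (hf : ∀ i, LowerSemicontinuous (f i)) :
    pairing ν (fun x => ∑ i ∈ t, f i x) = ∑ i ∈ t, pairing ν (f i) := by
  classical
  induction t using Finset.induction_on with
  | empty => simpa using pairing_zero ν
  | insert a t ha ih =>
    simp_rw [Finset.sum_insert ha]
    rw [pairing_add ν (hf a) (lowerSemicontinuous_sum fun i _ => hf i), ih]

theorem pairing_indicator (ν : ContinuousValuation X) (U : Opens X) :
    pairing ν ((U : Set X).indicator fun _ => 1) = ν U := by
  have h : simpleEval [(1, U)] = (U : Set X).indicator fun _ => 1 := by
    funext x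
    simp [simpleEval]
  rw [← h, pairing_simpleEval]
  simp [simpleInt]

theorem lowerSemicontinuous_eval (U : Opens X) :
    LowerSemicontinuous fun ν : ContinuousValuation X => ν U := by
  intro ν a ha
  obtain ⟨r, har, hr⟩ := ENNReal.lt_iff_exists_nnreal_btwn.1 ha
  have hopen : IsOpen {ν : ContinuousValuation X | (r : ℝ≥0∞) < ν U} :=
    isOpen_generateFrom_of_mem ⟨U, r, rfl⟩
  filter_upwards [hopen.mem_nhds hr] with ρ hρ
  exact har.trans hρ

theorem lowerSemicontinuous_const_mul_eval {c : ℝ≥0∞} (hc : c ≠ ∞) (U : Opens X) :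
    LowerSemicontinuous fun ν : ContinuousValuation X => c * ν U :=
  (ENNReal.continuous_const_mul hc).comp_lowerSemicontinuous
    (lowerSemicontinuous_eval U) (fun _ _ hab => mul_le_mul_right hab _)

/-- The evaluation `⟨-, g⟩ : VX → [0, ∞]` is lower semicontinuous. -/
theorem lowerSemicontinuous_pairing {g : X → ℝ≥0∞} (hg : LowerSemicontinuous g) :
    LowerSemicontinuous fun ν : ContinuousValuation X => pairing ν g := by
  simp_rw [pairing_eq_iSup _ hg, simpleInt_dyadSimple]
  exact lowerSemicontinuous_iSup fun n => lowerSemicontinuous_sum fun k _ =>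
    lowerSemicontinuous_const_mul_eval (ENNReal.div_lt_top (by simp) (by simp)).ne _

end Basic

/-! ### The valuation monad -/

section Monad

variable {X Y Z : Type u} [TopologicalSpace X] [TopologicalSpace Y] [TopologicalSpace Z]

theorem continuous_of_eval (F : Y → ContinuousValuation X)
    (h : ∀ U : Opens X, LowerSemicontinuous fun y => F y U) : Continuous F := by
  refine continuous_generateFrom_iff.2 ?_
  rintro _ ⟨U, r, rfl⟩
  exact (h U).isOpen_preimage r

/-- The pushforward `(f_* ν)(U) = ν(f⁻¹(U))`. -/
def map (f : C(X, Y)) (ν : ContinuousValuation X) : ContinuousValuation Y where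
  toFun U := ν (Opens.comap f U)
  strict := by
    rw [← ν.strict]
    rfl
  mono U V h := ν.mono _ _ fun _ hx => h hx
  modular U V := ν.modular (Opens.comap f U) (Opens.comap f V)
  scott 𝒰 hne hd := by
    rw [map_sSup, ν.scott _ (hne.image _), iSup_image]
    rintro _ ⟨U, hU, rfl⟩ _ ⟨V, hV, rfl⟩
    obtain ⟨W, hW, hUW, hVW⟩ := hd U hU V hV
    exact ⟨_, ⟨W, hW, rfl⟩, fun _ hx => hUW hx, fun _ hx => hVW hx⟩

theorem continuous_map (f : C(X, Y)) : Continuous (map f) :=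
  continuous_of_eval _ fun U => lowerSemicontinuous_eval (Opens.comap f U)

/-- `⟨f_* ν, g⟩ = ⟨ν, g ∘ f⟩`. -/
theorem pairing_map (f : C(X, Y)) (ν : ContinuousValuation X) {g : Y → ℝ≥0∞}
    (hg : LowerSemicontinuous g) : pairing (map f ν) g = pairing ν (g ∘ f) := by
  have hgf : LowerSemicontinuous (g ∘ f) := hg.comp f.continuous
  rw [pairing_eq_iSup _ hg, pairing_eq_iSup _ hgf]
  refine iSup_congr fun n => ?_
  rw [simpleInt_dyadSimple, simpleInt_dyadSimple]
  refine Finset.sum_congr rfl fun k _ => ?_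
  change _ * ν (Opens.comap f _) = _
  congr 2
  ext x
  change f x ∈ level g _ ↔ x ∈ level (g ∘ f) _
  rw [mem_level hg, mem_level hgf]
  rfl

/-- The point valuation `δ_x(U) = 1_U(x)`. -/
noncomputable def dirac (x : X) : ContinuousValuation X where
  toFun U := (U : Set X).indicator (fun _ => 1) x
  strict := by simp
  mono U V h := Set.indicator_le_indicator_of_subset h (fun _ => zero_le) x
  modular U V := by
    by_cases hU : x ∈ (U : Set X) <;> by_cases hV : x ∈ (V : Set X) <;>
      simp_all [Set.indicator]
  scott 𝒰 _ _ := by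
    classical
    by_cases h : ∃ U ∈ 𝒰, x ∈ U
    · rw [Set.indicator_of_mem (by simpa using h)]
      obtain ⟨U, hU, hx⟩ := h
      refine le_antisymm (le_iSup₂_of_le U hU ?_) (iSup₂_le fun V _ => Set.indicator_le_self _ _ _)
      rw [Set.indicator_of_mem (show x ∈ (U : Set X) from hx)]
    · rw [Set.indicator_of_notMem (by simpa using h)]
      push Not at h
      refine (iSup₂_eq_bot.2 fun U hU => ?_).symm
      exact Set.indicator_of_notMem (show x ∉ (U : Set X) from h U hU) _

theorem continuous_dirac : Continuous (dirac : X → ContinuousValuation X) :=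
  continuous_of_eval _ fun U => U.isOpen.lowerSemicontinuous_indicator zero_le

/-- `⟨δ_x, g⟩ = g(x)`. -/
theorem pairing_dirac (x : X) {g : X → ℝ≥0∞} (hg : LowerSemicontinuous g) :
    pairing (dirac x) g = g x := by
  rw [pairing_eq_iSup _ hg]
  conv_rhs => rw [← iSup_dyad (g x)]
  refine iSup_congr fun n => ?_
  rw [simpleInt_dyadSimple, dyad]
  refine Finset.sum_congr rfl fun k _ => ?_
  change _ * (level g _ : Set X).indicator (fun _ => 1) x = _
  rw [coe_level hg]
  simp [Set.indicator]

/-- The expected valuation `ℰξ`, given by `(ℰξ)(U) = ∫ ν(U) dξ(ν)`. -/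
noncomputable def expectation (ξ : ContinuousValuation (ContinuousValuation X)) :
    ContinuousValuation X where
  toFun U := pairing ξ fun ν => ν U
  strict := by
    simp_rw [ContinuousValuation.strict]
    exact pairing_zero ξ
  mono U V h := pairing_mono ξ fun ν => ν.mono _ _ h
  modular U V := by
    rw [← pairing_add ξ (lowerSemicontinuous_eval _) (lowerSemicontinuous_eval _),
      ← pairing_add ξ (lowerSemicontinuous_eval _) (lowerSemicontinuous_eval _)]
    simp_rw [ContinuousValuation.modular]
  scott 𝒰 hne hd := by
    have := hne.to_subtype
    have h1 : (fun ν : ContinuousValuation X => ν (sSup 𝒰)) = fun ν => ⨆ U : 𝒰, ν U := by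
      funext ν
      rw [ν.scott 𝒰 hne hd, iSup_subtype']
    rw [h1, pairing_iSup ξ _ (fun U => lowerSemicontinuous_eval _), iSup_subtype']
    rintro ⟨U, hU⟩ ⟨V, hV⟩
    obtain ⟨W, hW, hUW, hVW⟩ := hd U hU V hV
    exact ⟨⟨W, hW⟩, fun ν => ν.mono _ _ hUW, fun ν => ν.mono _ _ hVW⟩

theorem continuous_expectation :
    Continuous (expectation : ContinuousValuation (ContinuousValuation X) → _) :=
  continuous_of_eval _ fun U => lowerSemicontinuous_pairing (lowerSemicontinuous_eval U)

/-- `⟨ℰξ, g⟩ = ⟨ξ, ⟨-, g⟩⟩`. -/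
theorem pairing_expectation (ξ : ContinuousValuation (ContinuousValuation X)) {g : X → ℝ≥0∞}
    (hg : LowerSemicontinuous g) :
    pairing (expectation ξ) g = pairing ξ fun ν => pairing ν g := by
  have h2 : ∀ n : ℕ, (1 : ℝ≥0∞) / 2 ^ n ≠ ∞ := fun n =>
    (ENNReal.div_lt_top (by simp) (by simp)).ne
  rw [pairing_eq_iSup _ hg]
  simp_rw [pairing_eq_iSup _ hg]
  rw [pairing_iSup ξ]
  · refine iSup_congr fun n => ?_
    simp_rw [simpleInt_dyadSimple]
    rw [pairing_sum ξ _ _ fun k => lowerSemicontinuous_const_mul_eval (h2 n) _]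
    refine Finset.sum_congr rfl fun k _ => ?_
    rw [pairing_const_mul ξ _ (lowerSemicontinuous_eval _)]
    rfl
  · intro n
    simp_rw [simpleInt_dyadSimple]
    exact lowerSemicontinuous_sum fun k _ => lowerSemicontinuous_const_mul_eval (h2 n) _
  · exact Monotone.directed_le fun m n hmn ν => simpleInt_dyadSimple_monotone ν hg hmn

end Monad

end ContinuousValuation

/-- The functor `V : Top ⥤ Top` of continuous valuations. -/
def valuationFunctor : TopCat.{u} ⥤ TopCat.{u} where
  obj X := TopCat.of (ContinuousValuation X)
  map f := TopCat.ofHom ⟨ContinuousValuation.map f.hom, ContinuousValuation.continuous_map f.hom⟩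

/-- The valuation monad `(V, δ, ℰ)` on `Top`. -/
noncomputable def valuationMonad : CategoryTheory.Monad TopCat.{u} where
  toFunctor := valuationFunctor
  η :=
    { app := fun X => TopCat.ofHom
        ⟨ContinuousValuation.dirac, ContinuousValuation.continuous_dirac⟩
      naturality := fun _ _ _ => rfl }
  μ :=
    { app := fun X => TopCat.ofHom
        (⟨ContinuousValuation.expectation, ContinuousValuation.continuous_expectation⟩ :
          C(ContinuousValuation (ContinuousValuation X), ContinuousValuation X))
      naturality := fun X Y f => by
        ext ξ : 1
        refine ContinuousValuation.ext (funext fun U => ?_)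
        exact ContinuousValuation.pairing_map
          (⟨_, ContinuousValuation.continuous_map f.hom⟩ :
            C(ContinuousValuation X, ContinuousValuation Y)) ξ
          (ContinuousValuation.lowerSemicontinuous_eval U) }
  assoc X := by
    ext ξ : 1
    refine ContinuousValuation.ext (funext fun U => ?_)
    exact (ContinuousValuation.pairing_map
      (⟨_, ContinuousValuation.continuous_expectation⟩ :
        C(ContinuousValuation (ContinuousValuation X), ContinuousValuation X)) ξ
      (ContinuousValuation.lowerSemicontinuous_eval U)).trans
      (ContinuousValuation.pairing_expectation ξ
        (ContinuousValuation.lowerSemicontinuous_eval U)).symm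
  left_unit X := by
    ext ν : 1
    refine ContinuousValuation.ext (funext fun U => ?_)
    exact ContinuousValuation.pairing_dirac ν (ContinuousValuation.lowerSemicontinuous_eval U)
  right_unit X := by
    ext ν : 1
    refine ContinuousValuation.ext (funext fun U => ?_)
    exact (ContinuousValuation.pairing_map
      (⟨_, ContinuousValuation.continuous_dirac⟩ : C(X, ContinuousValuation X)) ν
      (ContinuousValuation.lowerSemicontinuous_eval U)).trans
      (ContinuousValuation.pairing_indicator ν U)

/-! ### `τ`-smooth Borel probability measures -/

/-- A `τ`-smooth Borel probability measure on `X`: a probability measure on the Borel `σ`-algebra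
that preserves suprema of directed families of opens. -/
@[ext]
structure TauSmoothProb (X : Type u) [TopologicalSpace X] where
  measure : @MeasureTheory.Measure X (borel X)
  isProbabilityMeasure : @MeasureTheory.IsProbabilityMeasure X (borel X) measure
  tauSmooth : ∀ 𝒰 : Set (Opens X), 𝒰.Nonempty → DirectedOn (· ≤ ·) 𝒰 →
    measure (⋃ U ∈ 𝒰, (U : Set X)) = ⨆ U ∈ 𝒰, measure (U : Set X)

namespace TauSmoothProb

variable {X Y : Type u} [TopologicalSpace X] [TopologicalSpace Y]

/-- The continuous valuation obtained by restricting a measure to the opens. -/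
def toValuation (p : TauSmoothProb X) : ContinuousValuation X where
  toFun U := p.measure U
  strict := by simp
  mono U V h := MeasureTheory.measure_mono h
  modular U V := by
    let _ := borel X
    exact MeasureTheory.measure_union_add_inter (U : Set X)
      (MeasurableSpace.measurableSet_generateFrom V.isOpen)
  scott 𝒰 hne hd := by
    rw [Opens.coe_sSup]
    exact p.tauSmooth 𝒰 hne hd

/-- The A-topology on `PX`, inherited from `VX`; it is generated by the sets `{p | p U > r}`. -/
instance : TopologicalSpace (TauSmoothProb X) :=
  TopologicalSpace.induced toValuation inferInstance

theorem topology_eq_generateFrom : (inferInstance : TopologicalSpace (TauSmoothProb X)) =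
    generateFrom {s | ∃ (U : Opens X) (r : ℝ≥0),
      s = {p : TauSmoothProb X | (r : ℝ≥0∞) < p.measure (U : Set X)}} := by
  refine induced_generateFrom_eq.trans (congrArg generateFrom ?_)
  ext s
  constructor
  · rintro ⟨_, ⟨U, r, rfl⟩, rfl⟩
    exact ⟨U, r, rfl⟩
  · rintro ⟨U, r, rfl⟩
    exact ⟨_, ⟨U, r, rfl⟩, rfl⟩

/-- The pushforward `(f_* p)(B) = p(f⁻¹(B))`. -/
noncomputable def map (f : C(X, Y)) (p : TauSmoothProb X) : TauSmoothProb Y where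
  measure := @MeasureTheory.Measure.map X Y (borel X) (borel Y) f p.measure
  isProbabilityMeasure :=
    @MeasureTheory.Measure.isProbabilityMeasure_map X Y (borel X) (borel Y) p.measure
      p.isProbabilityMeasure f
      (@Measurable.aemeasurable X Y (borel X) (borel Y) f p.measure f.continuous.borel_measurable)
  tauSmooth := by
    let _ := borel X
    let _ := borel Y
    intro 𝒰 hne hd
    have hmap : ∀ U : Opens Y, MeasureTheory.Measure.map f p.measure (U : Set Y) =
        p.measure (f ⁻¹' (U : Set Y)) := fun U =>
      MeasureTheory.Measure.map_apply f.continuous.borel_measurable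
        (MeasurableSpace.measurableSet_generateFrom U.isOpen)
    have h := (p.toValuation.map f).scott 𝒰 hne hd
    rw [← Opens.coe_sSup, hmap]
    simp_rw [hmap]
    exact h

theorem map_apply (f : C(X, Y)) (p : TauSmoothProb X) {B : Set Y} (hB : @MeasurableSet Y (borel Y) B) :
    (p.map f).measure B = p.measure (f ⁻¹' B) := by
  let _ := borel X
  let _ := borel Y
  exact MeasureTheory.Measure.map_apply f.continuous.borel_measurable hB

theorem toValuation_map (f : C(X, Y)) (p : TauSmoothProb X) :
    (p.map f).toValuation = p.toValuation.map f :=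
  ContinuousValuation.ext (funext fun U =>
    map_apply f p (MeasurableSpace.measurableSet_generateFrom U.isOpen))

theorem continuous_toValuation : Continuous (toValuation : TauSmoothProb X → _) :=
  continuous_induced_dom

theorem continuous_map (f : C(X, Y)) : Continuous (map f) := by
  refine continuous_induced_rng.2 ?_
  have h : toValuation ∘ map f = ContinuousValuation.map f ∘ toValuation :=
    funext fun p => toValuation_map f p
  rw [h]
  exact (ContinuousValuation.continuous_map f).comp continuous_toValuation

end TauSmoothProb

/-- The functor `P : Top ⥤ Top` of `τ`-smooth Borel probability measures. -/
noncomputable def probFunctor : TopCat.{u} ⥤ TopCat.{u} where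
  obj X := TopCat.of (TauSmoothProb X)
  map f := TopCat.ofHom ⟨TauSmoothProb.map f.hom, TauSmoothProb.continuous_map f.hom⟩
  map_id X := by
    ext p : 1
    exact TauSmoothProb.ext (@MeasureTheory.Measure.map_id X (borel X) p.measure)
  map_comp {X Y Z} f g := by
    ext p : 1
    exact TauSmoothProb.ext (@MeasureTheory.Measure.map_map X Y Z (borel X) (borel Y) (borel Z)
      p.measure g.hom f.hom g.hom.continuous.borel_measurable
      f.hom.continuous.borel_measurable).symm

/-- The inclusion `ι : P ⟶ V` that restricts a measure to the opens. -/
noncomputable def probInclusion : probFunctor.{u} ⟶ valuationFunctor.{u} where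
  app X := TopCat.ofHom ⟨TauSmoothProb.toValuation, TauSmoothProb.continuous_toValuation⟩
  naturality X Y f := by
    ext p : 1
    exact TauSmoothProb.toValuation_map f.hom p

/-! ### Pointwise form of the monad laws for valuations. -/

namespace ContinuousValuation

variable {X Y : Type u} [TopologicalSpace X] [TopologicalSpace Y]

/-! Restriction to opens makes `PX` a subspace of `VX`: the topology is induced by definition, and
injectivity is the π-λ theorem, since open sets form a π-system generating the Borel sets and the
measures are finite. Hence any equation between elements of `PX`, and the continuity of any map into
`PX`, may be checked in `VX`. It remains to see that the operations of `V` restrict to `P`.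

The Dirac measure restricts to the point valuation. For the multiplication, `p ↦ p(A)` is Borel: on
opens it is lower semicontinuous, and a π-λ argument reaches all Borel sets. So `A ↦ ∫ p(A) dμ(p)`
is a Borel measure. On an open set this Lebesgue integral equals the lower integral defining `ℰ`,
because both are limits of the same dyadic simple functions (`pairing_toValuation`). Thus the
average restricts to `ℰ(V(ι)(ι μ))` (`joinMeasure_coe`), which is Scott continuous; the average is
therefore `τ`-smooth, and `E` is compatible with `ℰ`. Naturality and the monad laws of `P` are then
pulled back from those of `V` along the injection `ι`. -/

theorem map_expectation (f : C(X, Y)) (ξ : ContinuousValuation (ContinuousValuation X)) :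
    (expectation ξ).map f = expectation (ξ.map ⟨map f, continuous_map f⟩) :=
  ContinuousValuation.ext (funext fun U =>
    (pairing_map ⟨map f, continuous_map f⟩ ξ (lowerSemicontinuous_eval U)).symm)

/-- Associativity of `ℰ`: this is `⟨ℰξ, g⟩ = ⟨ξ, ⟨-, g⟩⟩` with `g` the evaluation at an open set. -/
theorem expectation_map_expectation
    (ξ : ContinuousValuation (ContinuousValuation (ContinuousValuation X))) :
    expectation (ξ.map ⟨expectation, continuous_expectation⟩) = expectation (expectation ξ) :=
  ContinuousValuation.ext (funext fun U =>
    (pairing_map ⟨expectation, continuous_expectation⟩ ξ (lowerSemicontinuous_eval U)).trans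
      (pairing_expectation ξ (lowerSemicontinuous_eval U)).symm)

theorem expectation_dirac (ν : ContinuousValuation X) : expectation (dirac ν) = ν :=
  ContinuousValuation.ext (funext fun U => pairing_dirac ν (lowerSemicontinuous_eval U))

/-- Evaluation at `U`, composed with `x ↦ δ_x`, is the indicator of `U`, whose lower integral is `ν
U`. -/
theorem expectation_map_dirac (ν : ContinuousValuation X) :
    expectation (ν.map ⟨dirac, continuous_dirac⟩) = ν :=
  ContinuousValuation.ext (funext fun U =>
    (pairing_map ⟨dirac, continuous_dirac⟩ ν (lowerSemicontinuous_eval U)).trans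
      (pairing_indicator ν U))

theorem map_dirac (f : C(X, Y)) (x : X) : (dirac x).map f = dirac (f x) := rfl

theorem map_map {Z : Type u} [TopologicalSpace Z] (f : C(X, Y)) (g : C(Y, Z))
    (ν : ContinuousValuation X) : (ν.map f).map g = ν.map (g.comp f) := rfl

end ContinuousValuation

/-! ### Measures as valuations: embedding and comparison of integrals. -/

namespace TauSmoothProb

variable {X Y : Type u} [TopologicalSpace X] [TopologicalSpace Y]

theorem measurableSet_coe (U : Opens X) : @MeasurableSet X (borel X) (U : Set X) :=
  MeasurableSpace.measurableSet_generateFrom U.isOpen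

/-- A `τ`-smooth probability measure is determined by its values on open sets. -/
theorem toValuation_injective : Function.Injective (toValuation : TauSmoothProb X → _) := by
  intro p q h
  let _ := borel X
  have := p.isProbabilityMeasure
  -- Uniqueness on a generating π-system needs finite mass and equal total mass; the latter is
  -- agreement at `⊤`.
  refine TauSmoothProb.ext (MeasureTheory.ext_of_generate_finite {s : Set X | IsOpen s} rfl
    isPiSystem_isOpen (fun s hs => ?_) ?_)
  · exact congrArg (fun ν : ContinuousValuation X => ν ⟨s, hs⟩) h
  · exact congrArg (fun ν : ContinuousValuation X => ν ⊤) h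

theorem isEmbedding_toValuation :
    Topology.IsEmbedding (toValuation : TauSmoothProb X → _) :=
  ⟨⟨rfl⟩, toValuation_injective⟩

/-- The lower integral against the restriction of `p` is the Lebesgue integral against `p`. -/
theorem pairing_toValuation (p : TauSmoothProb X) {g : X → ℝ≥0∞} (hg : LowerSemicontinuous g) :
    p.toValuation.pairing g = @MeasureTheory.lintegral X (borel X) p.measure g := by
  let _ := borel X
  have : BorelSpace X := ⟨rfl⟩
  -- On simple functions the two integrals are the same finite sum.
  have hlint : ∀ s : List (ℝ≥0∞ × Opens X),
      ∫⁻ x, ContinuousValuation.simpleEval s x ∂p.measure = p.toValuation.simpleInt s := by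
    intro s
    induction s with
    | nil => simp [ContinuousValuation.simpleEval, ContinuousValuation.simpleInt]
    | cons a s ih =>
      simp only [ContinuousValuation.simpleEval, ContinuousValuation.simpleInt, List.map_cons,
        List.sum_cons] at ih ⊢
      rw [MeasureTheory.lintegral_add_left (measurable_const.indicator (measurableSet_coe a.2)),
        MeasureTheory.lintegral_indicator_const (measurableSet_coe a.2), ih]
      rfl
  rw [ContinuousValuation.pairing_eq_iSup _ hg]
  simp_rw [← hlint]
  -- Monotone convergence: the dyadic simple functions increase to `g`, and the lower integral is
  -- the supremum of their integrals.
  rw [← MeasureTheory.lintegral_iSup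
    (fun n => (ContinuousValuation.lowerSemicontinuous_simpleEval _).measurable)]
  · simp_rw [ContinuousValuation.simpleEval_dyadSimple _ hg, ContinuousValuation.iSup_dyad]
  · intro m n hmn x
    simp_rw [ContinuousValuation.simpleEval_dyadSimple _ hg]
    exact ContinuousValuation.dyad_monotone _ hmn

/-! ### Measurability of evaluations and the averaging map. -/

/-- The σ-algebra on measures is generated by evaluations. Since all measures here have mass one, it
suffices to test evaluations on the π-system of opens, where they are lower semicontinuous for the
A-topology and hence Borel. -/
theorem measurable_measure : @Measurable (TauSmoothProb X) (@MeasureTheory.Measure X (borel X))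
    (borel (TauSmoothProb X)) (@MeasureTheory.Measure.instMeasurableSpace X (borel X))
    measure := by
  let _ := borel X
  let _ := borel (TauSmoothProb X)
  have : BorelSpace (TauSmoothProb X) := ⟨rfl⟩
  have (p : TauSmoothProb X) := p.isProbabilityMeasure
  refine Measurable.measure_of_isPiSystem_of_isProbabilityMeasure
    (S := {s : Set X | IsOpen s}) rfl isPiSystem_isOpen fun s hs => ?_
  exact ((ContinuousValuation.lowerSemicontinuous_eval ⟨s, hs⟩).comp
    continuous_toValuation).measurable

theorem measurable_measure_apply {A : Set X} (hA : @MeasurableSet X (borel X) A) :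
    @Measurable (TauSmoothProb X) ℝ≥0∞ (borel (TauSmoothProb X)) (borel ℝ≥0∞)
      fun p => p.measure A :=
  @Measurable.comp _ _ _ (borel (TauSmoothProb X))
    (@MeasureTheory.Measure.instMeasurableSpace X (borel X)) (borel ℝ≥0∞) _ _
    (@MeasureTheory.Measure.measurable_coe X (borel X) A hA) measurable_measure

/-- The average `A ↦ ∫ p(A) dμ(p)` of a measure on the space of `τ`-smooth measures. -/
noncomputable def joinMeasure (μ : TauSmoothProb (TauSmoothProb X)) :
    @MeasureTheory.Measure X (borel X) :=
  @MeasureTheory.Measure.bind _ _ (borel (TauSmoothProb X)) (borel X) μ.measure measure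

theorem joinMeasure_apply (μ : TauSmoothProb (TauSmoothProb X)) {A : Set X}
    (hA : @MeasurableSet X (borel X) A) :
    joinMeasure μ A = @MeasureTheory.lintegral (TauSmoothProb X) (borel (TauSmoothProb X))
      μ.measure fun p => p.measure A := by
  let _ := borel X
  let _ := borel (TauSmoothProb X)
  exact MeasureTheory.Measure.bind_apply hA measurable_measure.aemeasurable

/-- The bridge between measures and valuations: the integrand `p ↦ p(U)` is lower semicontinuous, so
its Lebesgue integral is a lower integral, and it factors through `ι` as evaluation at `U`. -/
theorem joinMeasure_coe (μ : TauSmoothProb (TauSmoothProb X)) (U : Opens X) :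
    joinMeasure μ (U : Set X) =
      ContinuousValuation.expectation
        (μ.toValuation.map ⟨toValuation, continuous_toValuation⟩) U := by
  rw [joinMeasure_apply μ (measurableSet_coe U)]
  have hU := ContinuousValuation.lowerSemicontinuous_eval U
  exact ((ContinuousValuation.pairing_map ⟨toValuation, continuous_toValuation⟩
    μ.toValuation hU).trans (pairing_toValuation μ (hU.comp continuous_toValuation))).symm

/-- The averaging map `E : PPX → PX`. -/
noncomputable def join (μ : TauSmoothProb (TauSmoothProb X)) : TauSmoothProb X where
  measure := joinMeasure μ
  isProbabilityMeasure := by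
    let _ := borel X
    let _ := borel (TauSmoothProb X)
    have := μ.isProbabilityMeasure
    have (p : TauSmoothProb X) := p.isProbabilityMeasure
    refine ⟨?_⟩
    rw [joinMeasure_apply μ MeasurableSet.univ]
    simp
  -- Monotone convergence does not cover arbitrary directed families; the interchange of supremum
  -- and integral comes from Scott continuity of the expected valuation.
  tauSmooth 𝒰 hne hd := by
    rw [← Opens.coe_sSup]
    simp_rw [joinMeasure_coe]
    exact ContinuousValuation.scott _ 𝒰 hne hd

/-- Compatibility of `ι` with the multiplications; all laws for `E` are transferred through this
identity. -/
theorem toValuation_join (μ : TauSmoothProb (TauSmoothProb X)) :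
    (join μ).toValuation = ContinuousValuation.expectation
      (μ.toValuation.map ⟨toValuation, continuous_toValuation⟩) :=
  ContinuousValuation.ext (funext (joinMeasure_coe μ))

theorem continuous_join : Continuous (join : TauSmoothProb (TauSmoothProb X) → _) := by
  refine continuous_induced_rng.2 ?_
  rw [show toValuation ∘ join = _ from funext (toValuation_join (X := X))]
  exact ContinuousValuation.continuous_expectation.comp
    ((ContinuousValuation.continuous_map _).comp continuous_toValuation)

/-! ### The unit. -/

theorem dirac_apply (x : X) {A : Set X} (hA : @MeasurableSet X (borel X) A) :
    @MeasureTheory.Measure.dirac X (borel X) x A = A.indicator (fun _ => 1) x := by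
  let _ := borel X
  exact MeasureTheory.Measure.dirac_apply' x hA

/-- The Dirac measure at a point. -/
noncomputable def dirac (x : X) : TauSmoothProb X where
  measure := @MeasureTheory.Measure.dirac X (borel X) x
  isProbabilityMeasure := @MeasureTheory.Measure.dirac.isProbabilityMeasure X (borel X) x
  -- On opens the Dirac measure is the point valuation, already known to be Scott continuous.
  tauSmooth 𝒰 hne hd := by
    rw [← Opens.coe_sSup]
    simp_rw [dirac_apply x (measurableSet_coe _)]
    exact (ContinuousValuation.dirac x).scott 𝒰 hne hd

theorem toValuation_dirac (x : X) : (dirac x).toValuation = ContinuousValuation.dirac x :=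
  ContinuousValuation.ext (funext fun U => dirac_apply x (measurableSet_coe U))

theorem continuous_dirac : Continuous (dirac : X → TauSmoothProb X) := by
  refine continuous_induced_rng.2 ?_
  rw [show toValuation ∘ dirac = _ from funext (toValuation_dirac (X := X))]
  exact ContinuousValuation.continuous_dirac

/-! ### Naturality and monad laws, transferred along `ι`. -/

theorem map_dirac (f : C(X, Y)) (x : X) : (dirac x).map f = dirac (f x) := by
  apply toValuation_injective
  rw [toValuation_map, toValuation_dirac, toValuation_dirac]
  rfl

theorem map_join (f : C(X, Y)) (μ : TauSmoothProb (TauSmoothProb X)) :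
    (join μ).map f = join (μ.map ⟨map f, continuous_map f⟩) := by
  apply toValuation_injective
  rw [toValuation_map, toValuation_join, toValuation_join, toValuation_map]
  -- Naturality of `ι`, as an equation of continuous maps so that it can be used under a
  -- pushforward.
  have h : (⟨toValuation, continuous_toValuation⟩ :
        C(TauSmoothProb Y, ContinuousValuation Y)).comp ⟨map f, continuous_map f⟩ =
      (⟨ContinuousValuation.map f, ContinuousValuation.continuous_map f⟩ :
        C(ContinuousValuation X, ContinuousValuation Y)).comp
          ⟨toValuation, continuous_toValuation⟩ :=
    ContinuousMap.ext (toValuation_map f)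
  rw [ContinuousValuation.map_expectation, ContinuousValuation.map_map,
    ContinuousValuation.map_map, h]

/-- After applying `ι`, both sides are `ℰ` of a pushforward of `ι μ`; they agree by naturality and
associativity of `ℰ`. -/
theorem join_map_join (μ : TauSmoothProb (TauSmoothProb (TauSmoothProb X))) :
    join (μ.map ⟨join, continuous_join⟩) = join (join μ) := by
  apply toValuation_injective
  rw [toValuation_join, toValuation_join, toValuation_join, toValuation_map]
  let i : C(TauSmoothProb X, ContinuousValuation X) := ⟨toValuation, continuous_toValuation⟩
  -- The square `ι ∘ E = ℰ ∘ V(ι) ∘ ι`, which moves the inner average into `V`.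
  have h : i.comp ⟨join, continuous_join⟩ =
      ((⟨_, ContinuousValuation.continuous_expectation⟩ :
        C(ContinuousValuation (ContinuousValuation X), ContinuousValuation X)).comp
      ⟨_, ContinuousValuation.continuous_map i⟩).comp ⟨toValuation, continuous_toValuation⟩ :=
    ContinuousMap.ext toValuation_join
  rw [ContinuousValuation.map_map, h, ContinuousValuation.map_expectation,
    ← ContinuousValuation.expectation_map_expectation, ContinuousValuation.map_map,
    ContinuousValuation.map_map]

theorem join_dirac (p : TauSmoothProb X) : join (dirac p) = p := by
  apply toValuation_injective
  rw [toValuation_join, toValuation_dirac]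
  rw [ContinuousValuation.map_dirac]
  exact ContinuousValuation.expectation_dirac _

theorem join_map_dirac (p : TauSmoothProb X) : join (p.map ⟨dirac, continuous_dirac⟩) = p := by
  apply toValuation_injective
  rw [toValuation_join, toValuation_map]
  have h : (⟨toValuation, continuous_toValuation⟩ :
        C(TauSmoothProb X, ContinuousValuation X)).comp ⟨dirac, continuous_dirac⟩ =
      ⟨_, ContinuousValuation.continuous_dirac⟩ := ContinuousMap.ext toValuation_dirac
  rw [ContinuousValuation.map_map, h, ContinuousValuation.expectation_map_dirac]

end TauSmoothProb

/-! ### The submonad structure on `P`. -/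

/-- The unit `δ : 𝟭 ⟶ P` of Dirac measures. -/
noncomputable def probUnit : 𝟭 TopCat.{u} ⟶ probFunctor.{u} where
  app X := TopCat.ofHom ⟨TauSmoothProb.dirac, TauSmoothProb.continuous_dirac⟩
  naturality X Y f := by
    ext x : 1
    exact (TauSmoothProb.map_dirac f.hom x).symm

/-- The multiplication `E : PP ⟶ P` averaging a measure on the space of measures. -/
noncomputable def probMul : probFunctor.{u} ⋙ probFunctor.{u} ⟶ probFunctor.{u} where
  app X := TopCat.ofHom (⟨TauSmoothProb.join, TauSmoothProb.continuous_join⟩ :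
    C(TauSmoothProb (TauSmoothProb X), TauSmoothProb X))
  naturality X Y f := by
    ext μ : 1
    exact (TauSmoothProb.map_join f.hom μ).symm

theorem mainTheorem3 :
    ∃ (δ : 𝟭 TopCat.{u} ⟶ probFunctor.{u}) (E : probFunctor.{u} ⋙ probFunctor.{u} ⟶ probFunctor.{u}),
      -- `δ x` is the Dirac measure at `x`
      (∀ (X : TopCat.{u}) (x : X) (A : Set X), @MeasurableSet X (borel X) A →
        TauSmoothProb.measure ((δ.app X).hom x) A = A.indicator (fun _ => 1) x) ∧
      -- `E μ (A) = ∫ p(A) dμ(p)`, with measurable integrand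
      (∀ (X : TopCat.{u}) (μ : TauSmoothProb (TauSmoothProb X)) (A : Set X),
        @MeasurableSet X (borel X) A →
          @Measurable (TauSmoothProb X) ℝ≥0∞ (borel (TauSmoothProb X)) (borel ℝ≥0∞)
            (fun p => p.measure A) ∧
          TauSmoothProb.measure ((E.app X).hom μ) A =
            @MeasureTheory.lintegral (TauSmoothProb X) (borel (TauSmoothProb X)) μ.measure
              (fun p => p.measure A)) ∧
      -- `(P, δ, E)` is a monad, and the inclusion into the monad `V` is a morphism of monads
      -- which is a subspace embedding at every space
      ∃ (assoc : ∀ X, probFunctor.map (E.app X) ≫ E.app X = E.app (probFunctor.obj X) ≫ E.app X)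
        (left_unit : ∀ X, δ.app (probFunctor.obj X) ≫ E.app X = 𝟙 (probFunctor.obj X))
        (right_unit : ∀ X, probFunctor.map (δ.app X) ≫ E.app X = 𝟙 (probFunctor.obj X))
        (ι : MonadHom (CategoryTheory.Monad.mk probFunctor δ E assoc left_unit right_unit) valuationMonad.{u}),
        ι.toNatTrans = probInclusion.{u} ∧
        ∀ X : TopCat.{u}, Topology.IsEmbedding (ι.app X).hom := by
  refine ⟨probUnit, probMul, fun X x A hA => TauSmoothProb.dirac_apply x hA,
    fun X μ A hA => ⟨TauSmoothProb.measurable_measure_apply hA, TauSmoothProb.joinMeasure_apply μ hA⟩,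
    ?_, ?_, ?_, ?_, ?_, ?_⟩
  · intro X
    ext μ : 1
    exact TauSmoothProb.join_map_join μ
  · intro X
    ext p : 1
    exact TauSmoothProb.join_dirac p
  · intro X
    ext p : 1
    exact TauSmoothProb.join_map_dirac p
  · refine { toNatTrans := probInclusion, app_η := fun X => ?_, app_μ := fun X => ?_ }
    · ext x : 1
      exact TauSmoothProb.toValuation_dirac x
    · ext μ : 1
      refine (TauSmoothProb.toValuation_join μ).trans ?_
      -- The morphism axiom composes `P(ι)` with `ι` at `VX`, whereas the averaging identity uses
      -- `V(ι)` after `ι` at `PX`; the two agree by naturality of `ι`.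
      exact congrArg ContinuousValuation.expectation
        (TauSmoothProb.toValuation_map _ μ).symm
  · rfl
  · exact fun X => TauSmoothProb.isEmbedding_toValuation
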